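/- Let $F$ be a field and let $p(F)$ denote the additive order of the identity of $F$ (with $p(F)=\infty$ if this order is infinite). Let $n\geqslant 1$, $k\geqslant 1$ and $m\geqslant 0$ be integers, let $A_1,\ldots,A_n$ be finite nonempty subsets of $F$ with $|A_1|=\cdots=|A_n|=k$, and, for all $1\leqslant i\neq j\leqslant n$, let $S_{ij}$ be a finite subset of $F$ with $|S_{ij}|=m$. Put $$C=\{a_1+\cdots+a_n:\ a_1\in A_1,\ldots,a_n\in A_n,\ a_i-a_j\notin S_{ij}\ \text{if}\ i\neq j\}.$$ If $p(F)>mn$, then $$|C|\geqslant \min\{p(F),\ n(k-1)-mn(n-1)+1\}.$$ -/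

import Mathlib

/-- `p(F)`: the additive order of the identity of `F`, with the value `⊤` when this order is
infinite (Mathlib's `addOrderOf` returns `0` there). It takes values in `WithTop ℤ`
because it is compared with an integer that may be negative. -/
noncomputable def identityOrder (F : Type*) [Field F] : WithTop ℤ :=
  if addOrderOf (1 : F) = 0 then ⊤ else ((addOrderOf (1 : F) : ℤ) : WithTop ℤ)

/-- The restricted sumset
`C = {a₁ + ⋯ + aₙ : a₁ ∈ A₁, …, aₙ ∈ Aₙ, aᵢ - aⱼ ∉ Sᵢⱼ if i ≠ j}`;
the condition runs over all ordered pairs, and the values `S i i` play no role. -/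
def restrictedSumset {F : Type*} [Field F] {n : ℕ} (A : Fin n → Finset F)
    (S : Fin n → Fin n → Finset F) : Set F :=
  {c | ∃ a : Fin n → F, (∀ j, a j ∈ A j) ∧ (∀ i j, i ≠ j → a i - a j ∉ S i j) ∧
    c = ∑ j, a j}

/-- The restricted sumset is finite, so its `Set.ncard` is its genuine cardinality. -/
theorem restrictedSumset_finite {F : Type*} [Field F] {n : ℕ} (A : Fin n → Finset F)
    (S : Fin n → Fin n → Finset F) : (restrictedSumset A S).Finite := by
  classical
  refine ((Fintype.piFinset A).image (fun a => ∑ j, a j)).finite_toSet.subset ?_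
  rintro c ⟨a, ha, -, rfl⟩
  simp only [Finset.coe_image, Set.mem_image, Finset.mem_coe, Fintype.mem_piFinset]
  exact ⟨a, ha, rfl⟩

/-!
The proof is an application of the combinatorial Nullstellensatz. Put `N = n(k-1) - mn(n-1)` and
`M = min(N, p(F) - 1)`. If the restricted sumset `C` had at most `M` elements, the product of all
factors `xᵢ - xⱼ - s` (`i ≠ j`, `s ∈ Sᵢⱼ`) and of `M` factors `x₁ + ⋯ + xₙ - c`, among which every
`c ∈ C` occurs, would vanish on `A₁ × ⋯ × Aₙ`. Its degree is `mn(n-1) + M ≤ n(k-1)`, so that it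
suffices to find a monomial of this degree with all exponents at most `k - 1` and with nonzero
coefficient. The exponents `eᵢ` are chosen as equal as possible (`balancedExponent`).

The coefficient of a monomial of top degree only depends on the leading form, hence not on the
constants `s` and `c`, and these may be replaced by others. They are taken to be small integers,
such that on the grid `∏ {0, …, eᵢ}` the product has the single nonzero value at
`((n-1)m, …, m, 0)` (`coeff_avoidancePoly_ne_zero`). A polynomial of degree at most `|e|` with
exactly one nonzero value on such a grid has a nonzero coefficient at `x ^ e`, by the
Nullstellensatz again (`coeff_ne_zero_of_isolated_point`). The condition `p(F) > mn` makes the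
points of the grid distinct in `F` and the value at the exceptional point nonzero.

What remains is a statement about integer points whose coordinates are pairwise `m` or more apart
(`IsSpread`): the least coordinate sum is attained once, and on the grid at most `M` further
values of the sum occur (`IsSpread.le_sum`, `IsSpread.sum_le`, `IsSpread.eq_of_sum_eq`).
-/

/-! ### Leading forms and coefficients of top degree -/

section LeadingForm

open MvPolynomial

/-- `IsLeadingForm P d Q` says that `Q` is homogeneous of degree `d` and that `P - Q` has degree
less than `d`. Neither form is required to be nonzero. -/
def IsLeadingForm {σ R : Type*} [CommRing R] (P : MvPolynomial σ R) (d : ℕ)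
    (Q : MvPolynomial σ R) : Prop :=
  Q.IsHomogeneous d ∧ ∀ e : σ →₀ ℕ, d ≤ e.degree → coeff e P = coeff e Q

namespace IsLeadingForm

variable {σ R : Type*} [CommRing R]

theorem one : IsLeadingForm (1 : MvPolynomial σ R) 0 1 :=
  ⟨isHomogeneous_one σ R, fun _ _ => rfl⟩

theorem mul {P₁ P₂ Q₁ Q₂ : MvPolynomial σ R} {d₁ d₂ : ℕ} (h₁ : IsLeadingForm P₁ d₁ Q₁)
    (h₂ : IsLeadingForm P₂ d₂ Q₂) : IsLeadingForm (P₁ * P₂) (d₁ + d₂) (Q₁ * Q₂) := by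
  classical
  refine ⟨h₁.1.mul h₂.1, fun e he => ?_⟩
  rw [coeff_mul, coeff_mul]
  refine Finset.sum_congr rfl fun x hx => ?_
  have hdeg : x.1.degree + x.2.degree = e.degree := by
    rw [← map_add, Finset.HasAntidiagonal.mem_antidiagonal.mp hx]
  rcases lt_or_ge x.1.degree d₁ with hlt | hge
  · -- The other factor then has degree above `d₂`, where both of its coefficients vanish.
    rw [h₂.2 x.2 (by omega), h₂.1.coeff_eq_zero (d := x.2) (by omega), mul_zero, mul_zero]
  rcases lt_or_ge x.2.degree d₂ with hlt' | hge'
  · rw [h₁.2 x.1 (by omega), h₁.1.coeff_eq_zero (d := x.1) (by omega), zero_mul, zero_mul]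
  · rw [h₁.2 x.1 hge, h₂.2 x.2 hge']

theorem prod {ι : Type*} (s : Finset ι) {P Q : ι → MvPolynomial σ R} {d : ι → ℕ}
    (h : ∀ i ∈ s, IsLeadingForm (P i) (d i) (Q i)) :
    IsLeadingForm (∏ i ∈ s, P i) (∑ i ∈ s, d i) (∏ i ∈ s, Q i) := by
  classical
  induction s using Finset.induction_on with
  | empty => simpa using one
  | insert a s ha ih =>
    rw [Finset.prod_insert ha, Finset.prod_insert ha, Finset.sum_insert ha]
    exact (h a (Finset.mem_insert_self a s)).mul
      (ih fun i hi => h i (Finset.mem_insert_of_mem hi))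

theorem sub_C {L : MvPolynomial σ R} (hL : L.IsHomogeneous 1) (c : R) :
    IsLeadingForm (L - C c) 1 L := by
  classical
  refine ⟨hL, fun e he => ?_⟩
  have h0 : (0 : σ →₀ ℕ) ≠ e := by
    rintro rfl
    simp at he
  rw [coeff_sub, coeff_C, if_neg h0, sub_zero]

theorem prod_sub_C {ι : Type*} (s : Finset ι) {L : MvPolynomial σ R} (hL : L.IsHomogeneous 1)
    (c : ι → R) : IsLeadingForm (∏ i ∈ s, (L - C (c i))) s.card (L ^ s.card) := by
  simpa using prod s (d := fun _ => 1) fun i _ => sub_C hL (c i)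

theorem totalDegree_le {P Q : MvPolynomial σ R} {d : ℕ} (h : IsLeadingForm P d Q) :
    P.totalDegree ≤ d := by
  refine Finset.sup_le fun e he => ?_
  by_contra! hlt
  have hd : d < e.degree := hlt
  exact mem_support_iff.mp he ((h.2 e hd.le).trans (h.1.coeff_eq_zero hd.ne'))

end IsLeadingForm

/-- The combinatorial Nullstellensatz for a degree that is only bounded above. -/
theorem exists_eval_ne_zero_of_coeff_ne_zero {σ F : Type*} [Finite σ] [Field F]
    {P : MvPolynomial σ F} {e : σ →₀ ℕ} (hdeg : P.totalDegree ≤ e.degree) (he : coeff e P ≠ 0)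
    (A : σ → Finset F) (hA : ∀ i, e i < (A i).card) :
    ∃ x : σ → F, (∀ i, x i ∈ A i) ∧ eval x P ≠ 0 := by
  refine combinatorial_nullstellensatz_exists_eval_nonzero P e he (le_antisymm hdeg ?_) A hA
  exact le_totalDegree (mem_support_iff.mpr he)

/-- A converse to the combinatorial Nullstellensatz: if a polynomial of degree at most `|e|` has
exactly one nonzero value on a grid whose sides have `eᵢ + 1` elements, then the coefficient of
`x ^ e` is nonzero, since a multiple of an explicit product of linear factors, with leading
monomial `x ^ e`, takes the same values on the grid. -/
theorem coeff_ne_zero_of_isolated_point {σ F : Type*} [Fintype σ] [Field F]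
    {P : MvPolynomial σ F} {e : σ →₀ ℕ} (hdeg : P.totalDegree ≤ e.degree)
    (A : σ → Finset F) (hA : ∀ i, (A i).card = e i + 1) (a : σ → F) (ha : ∀ i, a i ∈ A i)
    (hPa : eval a P ≠ 0) (hP : ∀ x : σ → F, (∀ i, x i ∈ A i) → x ≠ a → eval x P = 0) :
    coeff e P ≠ 0 := by
  classical
  intro hcoeff
  set G : MvPolynomial σ F := ∏ i, ∏ b ∈ (A i).erase (a i), (X i - C b) with hG
  have hcard : ∀ i, ((A i).erase (a i)).card = e i := fun i => by
    rw [Finset.card_erase_of_mem (ha i), hA i, Nat.add_sub_cancel]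
  have hlead : IsLeadingForm G e.degree (monomial e 1) := by
    have h := IsLeadingForm.prod (Finset.univ : Finset σ)
      fun i _ => IsLeadingForm.prod_sub_C ((A i).erase (a i)) (isHomogeneous_X F i) fun b => b
    simp only [hcard] at h
    rw [monomial_eq, C_1, one_mul, Finsupp.prod_fintype _ _ fun i => pow_zero _,
      Finsupp.degree_eq_sum]
    exact h
  have hGa : eval a G ≠ 0 := by
    simp only [hG, map_prod, map_sub, eval_X, eval_C]
    refine Finset.prod_ne_zero_iff.mpr fun i _ => Finset.prod_ne_zero_iff.mpr fun b hb => ?_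
    exact sub_ne_zero.mpr (Finset.ne_of_mem_erase hb).symm
  set c : F := eval a P / eval a G with hc
  have hdeg' : (P - C c * G).totalDegree ≤ e.degree := by
    refine (totalDegree_sub _ _).trans (max_le hdeg ((totalDegree_mul _ _).trans ?_))
    rw [totalDegree_C, zero_add]
    exact hlead.totalDegree_le
  have hne : coeff e (P - C c * G) ≠ 0 := by
    rw [coeff_sub, hcoeff, coeff_C_mul, hlead.2 e le_rfl, coeff_monomial, if_pos rfl, mul_one,
      zero_sub]
    exact neg_ne_zero.mpr (div_ne_zero hPa hGa)
  obtain ⟨x, hx, hxne⟩ := exists_eval_ne_zero_of_coeff_ne_zero hdeg' hne A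
    fun i => by rw [hA i]; exact Nat.lt_succ_self _
  apply hxne
  rw [map_sub, map_mul, eval_C]
  by_cases hxa : x = a
  · rw [hxa, hc, div_mul_cancel₀ _ hGa, sub_self]
  · obtain ⟨i, hi⟩ := Function.ne_iff.mp hxa
    have hGx : eval x G = 0 := by
      simp only [hG, map_prod, map_sub, eval_X, eval_C]
      exact Finset.prod_eq_zero (Finset.mem_univ i)
        (Finset.prod_eq_zero (Finset.mem_erase.mpr ⟨hi, hx i⟩) (sub_self _))
    rw [hP x hx hxa, hGx, mul_zero, sub_self]

end LeadingForm

/-! ### Integer points with separated coordinates -/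

/-- The integer points at which no factor `xᵢ - xⱼ - t` vanishes, where `0 ≤ t < m` for `i < j`
and `1 ≤ t ≤ m` for `j < i`: any two coordinates differ by at least `m`, and by at least `m + 1`
if the coordinate with the larger index is the larger one. -/
def IsSpread {n : ℕ} (m : ℤ) (x : Fin n → ℤ) : Prop :=
  ∀ i j, i < j → m ≤ x i - x j ∨ m + 1 ≤ x j - x i

/-- The coordinates of a spread point can be listed so that they increase by at least `m` at each
step, and by at least `m + 1` where the index goes up. Equal coordinates (possible for `m = 0`)
are listed with decreasing index. -/
theorem IsSpread.exists_perm {n : ℕ} {m : ℤ} (hm : 0 ≤ m) {x : Fin n → ℤ} (hx : IsSpread m x) :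
    ∃ τ : Equiv.Perm (Fin n), ∀ a b, a < b →
      x (τ a) + m ≤ x (τ b) ∧ (τ a < τ b → x (τ a) + m + 1 ≤ x (τ b)) := by
  -- The key orders the coordinates by size, ties being broken by decreasing index.
  set z : Fin n → ℤ := fun i => n * x i - (i : ℕ) with hz
  have hmono := Tuple.monotone_sort z
  refine ⟨Tuple.sort z, fun a b hab => ?_⟩
  have hle : z (Tuple.sort z a) ≤ z (Tuple.sort z b) := hmono hab.le
  have hne : Tuple.sort z a ≠ Tuple.sort z b := fun h => hab.ne ((Tuple.sort z).injective h)
  generalize Tuple.sort z a = i at hle hne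
  generalize Tuple.sort z b = j at hle hne
  simp only [hz] at hle
  have hi := i.isLt
  have hj := j.isLt
  rcases lt_or_gt_of_ne hne with hij | hij
  · have hij' : (i : ℕ) < j := hij
    rcases hx i j hij with h | h
    · have : (n : ℤ) * x j ≤ n * x i := by
        apply mul_le_mul_of_nonneg_left _ (by positivity)
        linarith
      omega
    · exact ⟨by linarith, fun _ => by linarith⟩
  · have hij' : (j : ℕ) < i := hij
    refine ⟨?_, fun h => absurd h hij.asymm⟩
    rcases hx j i hij with h | h
    · linarith
    · have : (n : ℤ) * (x j + 1) ≤ n * x i := by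
        apply mul_le_mul_of_nonneg_left _ (by positivity)
        linarith
      rw [mul_add] at this
      omega

theorem sum_fin_ite_le (n r : ℕ) :
    (∑ i : Fin n, if r ≤ (i : ℕ) then 1 else 0) = n - r := by
  rw [Fin.sum_univ_eq_sum_range (fun i => if r ≤ i then 1 else 0) n,
    ← Finset.sum_filter, Finset.sum_const, smul_eq_mul, mul_one, ← Nat.card_Ico]
  congr 1
  ext i
  simp [and_comm]

/-- In the listing of a spread point by `IsSpread.exists_perm`, the coordinates are at least
`0, m, 2m, …`; where the index is `≥ r` one more is gained, either at the preceding index if that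
is `≥ r` too, or by the rise of the index from below `r`. -/
theorem le_sorted_of_gaps {n r : ℕ} {m : ℤ} {x : Fin n → ℤ} {τ : Equiv.Perm (Fin n)}
    (hτ : ∀ a b, a < b → x (τ a) + m ≤ x (τ b) ∧ (τ a < τ b → x (τ a) + m + 1 ≤ x (τ b)))
    (h0 : ∀ i : Fin n, (if r ≤ (i : ℕ) then 1 else 0) ≤ x i) (l : Fin n) :
    m * (l : ℕ) + (if r ≤ (τ l : ℕ) then 1 else 0) ≤ x (τ l) := by
  obtain ⟨l, hl⟩ := l
  induction l with
  | zero => simpa using h0 (τ ⟨0, hl⟩)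
  | succ l ih =>
    have ih := ih (by omega)
    obtain ⟨h1, h2⟩ := hτ ⟨l, by omega⟩ ⟨l + 1, hl⟩ (Nat.lt_succ_self l)
    rw [Fin.lt_def] at h2
    push_cast
    rw [mul_add, mul_one]
    split_ifs at ih ⊢ with ha hb hb
    all_goals first | linarith | (have := h2 (by omega); linarith)

theorem IsSpread.le_sum {n r : ℕ} (hr : r ≤ n) {m : ℤ} (hm : 0 ≤ m) {x : Fin n → ℤ}
    (hx : IsSpread m x) (h0 : ∀ i : Fin n, (if r ≤ (i : ℕ) then 1 else 0) ≤ x i) :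
    m * (∑ i : Fin n, ((i : ℕ) : ℤ)) + (n - r) ≤ ∑ i, x i := by
  obtain ⟨τ, hτ⟩ := hx.exists_perm hm
  have h := Finset.sum_le_sum fun l (_ : l ∈ Finset.univ) => le_sorted_of_gaps hτ h0 l
  rw [Finset.sum_add_distrib, ← Finset.mul_sum, Equiv.sum_comp τ x,
    Equiv.sum_comp τ fun i : Fin n => if r ≤ (i : ℕ) then (1 : ℤ) else 0] at h
  have hcount : (∑ i : Fin n, if r ≤ (i : ℕ) then (1 : ℤ) else 0) = n - r := by
    rw [← Nat.cast_sub hr, ← sum_fin_ite_le n r]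
    push_cast
    rfl
  rw [hcount] at h
  exact h

/-- The spread point with nonnegative coordinates of smallest sum is `((n - 1)m, …, m, 0)`. -/
theorem IsSpread.eq_of_sum_eq {n : ℕ} {m : ℤ} (hm : 0 ≤ m) {x : Fin n → ℤ}
    (hx : IsSpread m x) (h0 : ∀ i, 0 ≤ x i)
    (hsum : ∑ i, x i = m * ∑ i : Fin n, ((i : ℕ) : ℤ)) (i : Fin n) :
    x i = m * ((i.rev : ℕ) : ℤ) := by
  obtain ⟨τ, hτ⟩ := hx.exists_perm hm
  have hle : ∀ l : Fin n, m * (l : ℕ) ≤ x (τ l) := fun l => by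
    have h := le_sorted_of_gaps (r := n) hτ (fun i => by simpa [i.isLt.not_ge] using h0 i) l
    simpa [(τ l).isLt.not_ge] using h
  have heq : ∀ l : Fin n, m * ((l : ℕ) : ℤ) = x (τ l) := fun l => by
    refine (Finset.sum_eq_sum_iff_of_le fun l _ => hle l).mp ?_ l (Finset.mem_univ l)
    rw [← Finset.mul_sum, Equiv.sum_comp τ x, hsum]
  -- An increase of the index would cost an extra unit, so the listing reverses the indices.
  have hanti : StrictAnti τ := by
    cases n with
    | zero => exact fun a => a.elim0
    | succ n =>
      refine Fin.strictAnti_iff_succ_lt.mpr fun l => ?_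
      have hlt : l.castSucc < l.succ := Fin.castSucc_lt_succ
      by_contra hcon
      have hne : τ l.castSucc ≠ τ l.succ := fun h => hlt.ne (τ.injective h)
      have h := (hτ _ _ hlt).2 (lt_of_le_of_ne (not_lt.mp hcon) hne)
      rw [← heq, ← heq] at h
      simp only [Fin.val_castSucc, Fin.val_succ] at h
      push_cast at h
      linarith
  have hrev : (fun l => τ l) = Fin.rev := by
    have h : (fun l => τ l.rev) = id :=
      (StrictMono.range_inj (fun a b hab => hanti (Fin.rev_lt_rev.mpr hab)) strictMono_id).mp (by
        rw [Set.range_id]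
        exact (τ.surjective.comp Fin.rev_surjective).range_eq)
    funext l
    simpa using congrFun h l.rev
  have h := heq i.rev
  rw [congrFun hrev i.rev, Fin.rev_rev] at h
  exact h.symm

/-- Reflecting `x` to `K + 1 - x` turns the lower bound for sums of spread points into an upper
bound, for points below the corner `(K, …, K, K + 1, …, K + 1)` with `r` entries `K + 1`. -/
theorem IsSpread.sum_le {n r : ℕ} (hr : r ≤ n) {m K : ℤ} (hm : 0 ≤ m) {x : Fin n → ℤ}
    (hx : IsSpread m x) (hK : ∀ i : Fin n, x i ≤ K + (if n - r ≤ (i : ℕ) then 1 else 0)) :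
    ∑ i, x i ≤ n * K + r - m * ∑ i : Fin n, ((i : ℕ) : ℤ) := by
  have hx' : IsSpread m fun i : Fin n => K + 1 - x i.rev := fun i j hij => by
    have := hx j.rev i.rev (Fin.rev_lt_rev.mpr hij)
    dsimp only
    omega
  have h := hx'.le_sum hr hm fun i => by
    have h1 := hK i.rev
    have h2 := i.isLt
    rw [Fin.val_rev] at h1
    split_ifs at h1 ⊢ <;> omega
  have hrev : ∑ i : Fin n, x i.rev = ∑ i, x i := Equiv.sum_comp Fin.revPerm x
  rw [Finset.sum_sub_distrib, hrev] at h
  simp only [Finset.sum_const, Finset.card_univ, Fintype.card_fin, nsmul_eq_mul] at h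
  linarith

/-! ### The polynomial of the forbidden differences and sums -/

section AvoidancePoly

open MvPolynomial

variable {F : Type*} [Field F]

/-- The polynomial with factors `xᵢ - xⱼ - s i j t`, for `i ≠ j` and `t < m`, and
`x₁ + ⋯ + xₙ - c t`, for `t < M`. The forbidden values are given as sequences, so that repetitions
can make up for sets with fewer than `m` or `M` elements. -/
noncomputable def avoidancePoly (n m M : ℕ) (s : Fin n → Fin n → ℕ → F)
    (c : ℕ → F) : MvPolynomial (Fin n) F :=
  (∏ p ∈ (Finset.univ : Finset (Fin n)).offDiag, ∏ t ∈ Finset.range m,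
    (X p.1 - X p.2 - C (s p.1 p.2 t))) * ∏ t ∈ Finset.range M, (∑ i, X i - C (c t))

theorem eval_avoidancePoly_ne_zero_iff {n m M : ℕ} {s : Fin n → Fin n → ℕ → F} {c : ℕ → F}
    {x : Fin n → F} : eval x (avoidancePoly n m M s c) ≠ 0 ↔
      (∀ i j, i ≠ j → ∀ t < m, x i - x j ≠ s i j t) ∧ ∀ t < M, ∑ i, x i ≠ c t := by
  simp [avoidancePoly, Finset.prod_eq_zero_iff, sub_eq_zero]

theorem isLeadingForm_avoidancePoly (n m M : ℕ) (s : Fin n → Fin n → ℕ → F) (c : ℕ → F) :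
    IsLeadingForm (avoidancePoly n m M s c) (n * (n - 1) * m + M)
      ((∏ p ∈ (Finset.univ : Finset (Fin n)).offDiag, (X p.1 - X p.2) ^ m) *
        (∑ i, X i) ^ M) := by
  have h := (IsLeadingForm.prod (Finset.univ : Finset (Fin n)).offDiag fun p _ =>
    IsLeadingForm.prod_sub_C (Finset.range m)
      ((isHomogeneous_X F p.1).sub (isHomogeneous_X F p.2)) (s p.1 p.2)).mul
    (IsLeadingForm.prod_sub_C (Finset.range M)
      (IsHomogeneous.sum Finset.univ (fun i : Fin n => (X i : MvPolynomial (Fin n) F)) 1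
        fun i _ => isHomogeneous_X F i) c)
  simpa [Finset.offDiag_card, Nat.mul_sub, avoidancePoly] using h

/-- The exponents `m(n-1) + ⌊M/n⌋` and, for the last `M % n` indices,
`m(n-1) + ⌊M/n⌋ + 1`: the most balanced distribution of the degree of `avoidancePoly`. -/
noncomputable def balancedExponent (n m M : ℕ) : Fin n →₀ ℕ :=
  Finsupp.equivFunOnFinite.symm fun i =>
    m * (n - 1) + M / n + if n - M % n ≤ (i : ℕ) then 1 else 0

theorem balancedExponent_apply (n m M : ℕ) (i : Fin n) : balancedExponent n m M i =
    m * (n - 1) + M / n + if n - M % n ≤ (i : ℕ) then 1 else 0 := rfl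

theorem mul_div_add_mod {n : ℕ} (m M : ℕ) :
    n * (m * (n - 1) + M / n) + M % n = n * (n - 1) * m + M := by
  have := Nat.div_add_mod M n
  rw [mul_add, add_assoc, this]
  ring

theorem degree_balancedExponent {n : ℕ} (hn : 0 < n) (m M : ℕ) :
    (balancedExponent n m M).degree = n * (n - 1) * m + M := by
  have hr := Nat.mod_lt M hn
  simp only [Finsupp.degree_eq_sum, balancedExponent_apply]
  rw [Finset.sum_add_distrib, sum_fin_ite_le, Nat.sub_sub_self hr.le]
  simpa using mul_div_add_mod m M

theorem balancedExponent_le {n : ℕ} (hn : 0 < n) {m M L : ℕ}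
    (h : n * (n - 1) * m + M ≤ n * L) (i : Fin n) : balancedExponent n m M i ≤ L := by
  rw [balancedExponent_apply]
  rw [← mul_div_add_mod m M] at h
  generalize m * (n - 1) + M / n = K at h ⊢
  have hK : K ≤ L := Nat.le_of_mul_le_mul_left (by omega : n * K ≤ n * L) hn
  split_ifs with hi
  · have hr : 0 < M % n := by have := i.isLt; omega
    have : K < L := Nat.lt_of_mul_lt_mul_left (by omega : n * K < n * L)
    omega
  · omega

/-- The coefficient of `avoidancePoly` at the balanced exponent depends only on the leading form,
so the forbidden values may be chosen at will. They are chosen such that, on the grid of the points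
`(y₁, …, yₙ)` with `0 ≤ yᵢ ≤ eᵢ`, only `((n - 1)m, …, m, 0)` is not a zero: all other spread
points have one of the `M` next larger coordinate sums. -/
theorem coeff_avoidancePoly_ne_zero {n m M L : ℕ} (hn : 0 < n) (hML : M ≤ L) (hmL : m * n ≤ L)
    (hL : ∀ z : ℕ, 0 < z → z ≤ L → (z : F) ≠ 0) (s : Fin n → Fin n → ℕ → F) (c : ℕ → F) :
    coeff (balancedExponent n m M) (avoidancePoly n m M s c) ≠ 0 := by
  classical
  have hLint : ∀ z : ℤ, z ≠ 0 → |z| ≤ L → (z : F) ≠ 0 := fun z hz hzL h => by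
    have := abs_le.mp hzL
    refine hL z.natAbs (Int.natAbs_pos.mpr hz) (by omega) ?_
    rcases Int.natAbs_eq z with h' | h' <;> rw [h'] at h <;> simpa using h
  have hn1 : m * (n - 1) + m = m * n := by
    rw [← Nat.mul_succ, Nat.succ_eq_add_one, Nat.sub_add_cancel hn]
  have heL : ∀ i, balancedExponent n m M i ≤ L := balancedExponent_le hn (by
    calc n * (n - 1) * m + M = m * n * (n - 1) + M := by ring
      _ ≤ L * (n - 1) + L := by gcongr
      _ = n * L := by rw [← Nat.mul_succ, Nat.succ_eq_add_one, Nat.sub_add_cancel hn, mul_comm])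
  set B : ℤ := m * ∑ i : Fin n, ((i : ℕ) : ℤ) with hB
  set s₀ : Fin n → Fin n → ℕ → F := fun i j t => if i < j then (t : F) else (t : F) + 1 with hs₀
  set c₀ : ℕ → F := fun t => ((B + t + 1 : ℤ) : F) with hc₀
  have hcoeff : coeff (balancedExponent n m M) (avoidancePoly n m M s c) =
      coeff (balancedExponent n m M) (avoidancePoly n m M s₀ c₀) := by
    have hd := (degree_balancedExponent hn m M).ge
    rw [(isLeadingForm_avoidancePoly n m M s c).2 _ hd,
      (isLeadingForm_avoidancePoly n m M s₀ c₀).2 _ hd]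
  rw [hcoeff]
  refine coeff_ne_zero_of_isolated_point
    ((isLeadingForm_avoidancePoly n m M s₀ c₀).totalDegree_le.trans
      (degree_balancedExponent hn m M).ge)
    (fun i => (Finset.range (balancedExponent n m M i + 1)).image fun z : ℕ => (z : F)) ?_
    (fun i => ((m * (i.rev : ℕ) : ℕ) : F)) ?_ ?_ ?_
  · intro i
    rw [Finset.card_image_of_injOn, Finset.card_range]
    intro a ha b hb hab
    have ha' := Finset.mem_range.mp ha
    have hb' := Finset.mem_range.mp hb
    have hi := heL i
    by_contra hne
    refine hLint ((a : ℤ) - b) (by omega) (by rw [abs_le]; omega) ?_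
    push_cast
    exact sub_eq_zero.mpr hab
  · intro i
    refine Finset.mem_image_of_mem _ (Finset.mem_range.mpr (Nat.lt_succ_of_le ?_))
    rw [balancedExponent_apply]
    have : m * (i.rev : ℕ) ≤ m * (n - 1) := Nat.mul_le_mul_left m (by omega)
    exact this.trans ((Nat.le_add_right _ _).trans (Nat.le_add_right _ _))
  · rw [eval_avoidancePoly_ne_zero_iff]
    constructor
    · intro i j hij t ht
      rw [← sub_ne_zero]
      have hi : (i.rev : ℕ) ≤ n - 1 := by omega
      have hj : (j.rev : ℕ) ≤ n - 1 := by omega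
      have hi' : m * (i.rev : ℕ) ≤ m * (n - 1) := Nat.mul_le_mul_left m hi
      have hj' : m * (j.rev : ℕ) ≤ m * (n - 1) := Nat.mul_le_mul_left m hj
      rcases lt_or_gt_of_ne hij with h | h
      · have hlt : (j.rev : ℕ) + 1 ≤ i.rev := Fin.rev_lt_rev.mpr h
        have hm' : m * ((j.rev : ℕ) + 1) ≤ m * i.rev := Nat.mul_le_mul_left m hlt
        rw [mul_add, mul_one] at hm'
        have := hLint (((m * (i.rev : ℕ) : ℕ) : ℤ) - ((m * (j.rev : ℕ) : ℕ) : ℤ) - t)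
          (by omega) (by rw [abs_le]; omega)
        simpa [hs₀, h] using this
      · have hlt : (i.rev : ℕ) + 1 ≤ j.rev := Fin.rev_lt_rev.mpr h
        have hm' : m * ((i.rev : ℕ) + 1) ≤ m * j.rev := Nat.mul_le_mul_left m hlt
        rw [mul_add, mul_one] at hm'
        have := hLint (((m * (i.rev : ℕ) : ℕ) : ℤ) - ((m * (j.rev : ℕ) : ℕ) : ℤ) - (t + 1))
          (by omega) (by rw [abs_le]; omega)
        simpa [hs₀, h.asymm] using this
    · intro t ht
      have hsum : ∑ i : Fin n, ((m * (i.rev : ℕ) : ℕ) : F) = ((B : ℤ) : F) := by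
        refine (Equiv.sum_comp Fin.revPerm fun i : Fin n => ((m * (i : ℕ) : ℕ) : F)).trans ?_
        rw [hB, Finset.mul_sum]
        push_cast
        rfl
      rw [hsum, ne_comm, ← sub_ne_zero]
      have := hLint (t + 1) (by omega) (by rw [abs_le]; omega)
      simp only [hc₀]
      push_cast at this ⊢
      rwa [add_assoc, add_sub_cancel_left]
  · intro x hx hxa
    choose y hy hyx using fun i => Finset.mem_image.mp (hx i)
    obtain rfl : (fun i => (y i : F)) = x := funext hyx
    by_contra hne
    obtain ⟨h1, h2⟩ := eval_avoidancePoly_ne_zero_iff.mp hne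
    have hspread : IsSpread (m : ℤ) fun i => (y i : ℤ) := by
      intro i j hij
      by_contra! hcon
      rcases le_or_gt (y j) (y i) with hle | hlt
      · refine h1 i j hij.ne (y i - y j) (by omega) ?_
        simp [hs₀, hij, Nat.cast_sub hle]
      · refine h1 j i hij.ne' (y j - y i - 1) (by omega) ?_
        have : ((y j - y i - 1 : ℕ) : F) + 1 = (y j : F) - y i := by
          rw [← Nat.cast_sub hlt.le, ← Nat.cast_succ]
          congr 1
          omega
        simp [hs₀, hij.asymm, this]
    have hm0 : (0 : ℤ) ≤ m := by positivity
    have hlow := hspread.le_sum le_rfl hm0 fun i => by simp [i.isLt.not_ge]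
    have hup := hspread.sum_le (r := M % n) (K := ((m * (n - 1) + M / n : ℕ) : ℤ))
      (Nat.mod_lt M hn).le hm0 fun i => by
        have := Finset.mem_range.mp (hy i)
        rw [balancedExponent_apply] at this
        split_ifs at this ⊢ <;> omega
    rw [← hB] at hlow hup
    have hdeg : (n : ℤ) * ((m * (n - 1) + M / n : ℕ) : ℤ) + ((M % n : ℕ) : ℤ) = B * 2 + M := by
      have h := congrArg (Nat.cast : ℕ → ℤ) (mul_div_add_mod (n := n) m M)
      have h' := Finset.sum_range_id_mul_two n
      rw [← Fin.sum_univ_eq_sum_range (fun i => i) n] at h'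
      have h'' := congrArg (Nat.cast : ℕ → ℤ) h'
      push_cast [-Nat.cast_sub] at h h'' ⊢
      rw [hB]
      linear_combination h - (m : ℤ) * h''
    have hsumle : ∑ i, (y i : ℤ) ≤ B + M := by linarith
    rcases (show B ≤ ∑ i, (y i : ℤ) by linarith).eq_or_lt with heq | hlt
    · apply hxa
      funext i
      have h := hspread.eq_of_sum_eq hm0 (fun i => by positivity) heq.symm i
      have h' : y i = m * (i.rev : ℕ) := by exact_mod_cast h
      rw [h']
    · obtain ⟨t, ht⟩ := Int.eq_ofNat_of_zero_le (show 0 ≤ ∑ i, (y i : ℤ) - B - 1 by linarith)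
      refine h2 t (by omega) ?_
      have : ∑ i, (y i : ℤ) = B + t + 1 := by linarith
      simp only [hc₀]
      rw [← this]
      push_cast
      rfl

theorem exists_seq_of_card_le {s : Finset F} {m : ℕ} (hs : s.card ≤ m) :
    ∃ f : ℕ → F, ∀ x ∈ s, ∃ t < m, f t = x := by
  refine ⟨fun t => s.toList.getD t 0, fun x hx => ?_⟩
  obtain ⟨t, ht, rfl⟩ := List.mem_iff_getElem.mp (Finset.mem_toList.mpr hx)
  refine ⟨t, ?_, List.getD_eq_getElem _ _ ht⟩
  rw [Finset.length_toList] at ht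
  omega

/-- The lower bound in a form that covers all characteristics: `L` bounds the range in which
positive integers are nonzero in `F`. The sets `Aⱼ` have `k + 1` elements here. -/
theorem lt_ncard_restrictedSumset {n m k M L : ℕ} (hn : 0 < n) {A : Fin n → Finset F}
    {S : Fin n → Fin n → Finset F} (hA : ∀ j, (A j).card = k + 1)
    (hS : ∀ i j, i ≠ j → (S i j).card = m) (hM : n * (n - 1) * m + M ≤ n * k) (hML : M ≤ L)
    (hmL : m * n ≤ L) (hL : ∀ z : ℕ, 0 < z → z ≤ L → (z : F) ≠ 0) :
    M < (restrictedSumset A S).ncard := by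
  classical
  by_contra! hcard
  have hfin := restrictedSumset_finite A S
  rw [Set.ncard_eq_toFinset_card _ hfin] at hcard
  obtain ⟨c, hc⟩ := exists_seq_of_card_le hcard
  have hS' : ∀ i j, ∃ f : ℕ → F, i ≠ j → ∀ x ∈ S i j, ∃ t < m, f t = x := fun i j => by
    by_cases hij : i = j
    · exact ⟨0, fun h => absurd hij h⟩
    · obtain ⟨f, hf⟩ := exists_seq_of_card_le (hS i j hij).le
      exact ⟨f, fun _ => hf⟩
  choose s hs using hS'
  obtain ⟨x, hxA, hx⟩ := exists_eval_ne_zero_of_coeff_ne_zero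
    ((isLeadingForm_avoidancePoly n m M s c).totalDegree_le.trans
      (degree_balancedExponent hn m M).ge)
    (coeff_avoidancePoly_ne_zero hn hML hmL hL s c) A
    fun i => by rw [hA i]; exact Nat.lt_succ_of_le (balancedExponent_le hn hM i)
  obtain ⟨h1, h2⟩ := eval_avoidancePoly_ne_zero_iff.mp hx
  have hmem : ∑ i, x i ∈ hfin.toFinset := by
    rw [Set.Finite.mem_toFinset]
    refine ⟨x, hxA, fun i j hij hmem => ?_, rfl⟩
    obtain ⟨t, ht, hts⟩ := hs i j hij _ hmem
    exact h1 i j hij t ht hts.symm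
  obtain ⟨t, ht, htc⟩ := hc _ hmem
  exact h2 t ht htc.symm

end AvoidancePoly

/-! ### The lower bound -/

theorem theorem1p3 {F : Type*} [Field F] (n m k : ℕ)
    (A : Fin n → Finset F) (S : Fin n → Fin n → Finset F)
    (hne : ∀ j, (A j).Nonempty)
    (hA : ∀ j, (A j).card = k)
    (hS : ∀ i j, i ≠ j → (S i j).card = m)
    (hp : (((m : ℤ) * (n : ℤ) : ℤ) : WithTop ℤ) < identityOrder F) :
    min (identityOrder F)
        (((n : ℤ) * ((k : ℤ) - 1) - (m : ℤ) * (n : ℤ) * ((n : ℤ) - 1) + 1 : ℤ) : WithTop ℤ)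
      ≤ (((restrictedSumset A S).ncard : ℤ) : WithTop ℤ) := by
  rcases Nat.eq_zero_or_pos n with rfl | hn
  · -- The empty sum is the only element.
    have h : restrictedSumset A S = {0} := by
      ext c
      simp [restrictedSumset]
    rw [h, Set.ncard_singleton]
    exact (min_le_right _ _).trans (by norm_num)
  obtain ⟨k, rfl⟩ : ∃ l, k = l + 1 :=
    Nat.exists_eq_succ_of_ne_zero (by rw [← hA ⟨0, hn⟩]; exact (hne _).card_pos.ne')
  rcases lt_or_ge (n * k) (n * (n - 1) * m) with hneg | hpos
  · -- The bound is not positive.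
    refine (min_le_right _ _).trans (WithTop.coe_le_coe.mpr ?_)
    have h : ((n * k : ℕ) : ℤ) < ((n * (n - 1) * m : ℕ) : ℤ) := by exact_mod_cast hneg
    push_cast [Nat.cast_sub (Nat.one_le_iff_ne_zero.mpr hn.ne')] at h ⊢
    nlinarith
  obtain ⟨N, hN⟩ := Nat.exists_eq_add_of_le hpos
  have hNint : (n : ℤ) * (((k + 1 : ℕ) : ℤ) - 1) - (m : ℤ) * n * ((n : ℤ) - 1) + 1 = N + 1 := by
    have h : ((n * k : ℕ) : ℤ) = ((n * (n - 1) * m + N : ℕ) : ℤ) := by exact_mod_cast hN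
    push_cast [Nat.cast_sub (Nat.one_le_iff_ne_zero.mpr hn.ne')] at h ⊢
    linarith
  rw [hNint]
  by_cases h0 : addOrderOf (1 : F) = 0
  · refine (min_le_right _ _).trans (WithTop.coe_le_coe.mpr ?_)
    have := lt_ncard_restrictedSumset (M := N) (L := max N (m * n)) hn hA hS hN.ge
      (le_max_left _ _) (le_max_right _ _) fun z hz _ h => by
        have := addOrderOf_dvd_iff_nsmul_eq_zero.mpr (show z • (1 : F) = 0 by simpa using h)
        rw [h0, zero_dvd_iff] at this
        omega
    omega
  · have hid : identityOrder F = ((addOrderOf (1 : F) : ℤ) : WithTop ℤ) := by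
      rw [identityOrder, if_neg h0]
    rw [hid] at hp ⊢
    have hp' : m * n < addOrderOf (1 : F) := by exact_mod_cast WithTop.coe_lt_coe.mp hp
    -- If the bound exceeds the characteristic `p`, only `p - 1` factors for sums are used.
    have := lt_ncard_restrictedSumset (M := min N (addOrderOf (1 : F) - 1))
      (L := addOrderOf (1 : F) - 1) hn hA hS (by omega) (min_le_right _ _) (by omega)
      fun z hz hzL h => by
        have := Nat.le_of_dvd hz
          (addOrderOf_dvd_iff_nsmul_eq_zero.mpr (show z • (1 : F) = 0 by simpa using h))
        omega
    rw [← WithTop.coe_min]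
    refine WithTop.coe_le_coe.mpr ?_
    omega
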